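/- Fix a set $\mathit{Var}$ of variables, a set $A$ of actions, and a signature $\Sigma$, that is, a set of function symbols with finite arities. **Terms.** The terms $\mathbb{T}(\Sigma)$ are built from variables, operator applications $f(t_1,\dots,t_n)$, and recursion terms $\langle X|S\rangle$. Here $S=\{Y=S_Y\mid Y\in V_S\}$ with $V_S\subseteq\mathit{Var}$ is a recursive specification, with arbitrary terms $S_Y$ (the set $V_S$ may be infinite), $X\in V_S$, and the variables in $V_S$ are bound in $\langle X|S\rangle$. Write $\mathbb{T}(\Sigma,W)$ for the terms with free variables in $W$, and $\mathsf{T}(\Sigma)=\mathbb{T}(\Sigma,\emptyset)$ for the closed terms. Substitution $t[\sigma]$ avoids capture, and $\langle t|S\rangle:=t[\langle Y|S\rangle/Y]_{Y\in V_S}$. **TSSs.** A transition system specification (TSS) $P$ is a set of rules $\frac{H}{t\xrightarrow{a}u}$, where $H$ is a set of positive literals $t'\xrightarrow{b}u'$ and negative literals $t'\stackrel{b}{\nrightarrow}$. It is positive if no rule has a negative premise. A proof of $\frac{H}{\alpha}$ from $P$ is a well-founded, possibly infinitely branching, tree of literals with root $\alpha$ in which each node either is a leaf in $H$ or forms, together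 with its children, a substitution instance of a rule of $P$. **Format.** A positive TSS is in the tyft/tyxt format with recursion if * for every recursive specification $S$, every $X\in V_S$ and every $a\in A$ it contains a rule $\frac{\langle S_X|S\rangle\xrightarrow{a}z}{\langle X|S\rangle\xrightarrow{a}z}$ with $z$ a variable not free in $\langle X|S\rangle$; and * in each of its other rules, the source is either a variable or of the form $f(x_1,\dots,x_n)$ with distinct variables $x_i$, and the right-hand sides of the premises are pairwise distinct variables not occurring in the source. **Bisimilarity.** Let $\langle CT,PT\rangle$ be the well-founded semantics of $P$. Thus, for ordinals $\lambda$, $PT_\lambda$ is the set of closed transitions provable from the closed negative literals $p\stackrel{a}{\nrightarrow}$ not denied by any transition $p\xrightarrow{a}q$ in $\bigcup_{\kappa<\lambda}CT_\kappa$; $CT_\lambda$ is the set of closed transitions provable from the closed negative literals not denied by any transition in $PT_\lambda$; and $CT=\bigcup_\lambda CT_\lambda$, $PT=\bigcap_\lambda PT_\lambda$. (For positive $P$, both $CT$ and $PT$ are simply the set of provable closed transitions.) A bisimulation is a relation $R$ on $\mathsf{T}(\Sigma)$ such that, whenever $p\,R\,q$ and $a\in A$: each $p\xrightarrow{a}p'$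 in $CT$ is matched by some $q\xrightarrow{a}q'$ in $CT$ with $p'\,R\,q'$, and each $q\xrightarrow{a}q'$ in $PT$ is matched by some $p\xrightarrow{a}p'$ in $PT$ with $p'\,R\,q'$. Write $p\sqsubseteq_B q$ (bisimilarity) if some bisimulation relates $p$ to $q$, and ${\equiv_B}:={\sqsubseteq_B}\cap{\sqsupseteq_B}$. **Theorem.** Let $P$ be a positive TSS in the tyft/tyxt format with recursion. Then bisimilarity is a full congruence. That is, $\sqsubseteq_B$ is reflexive, transitive and symmetric (so it coincides with $\equiv_B$), and, writing $\sim$ for it: 1. for every $n$-ary function symbol $f$ of $\Sigma$ and all closed $p_i,q_i$: if $p_i\sim q_i$ for $i=1,\dots,n$, then $f(p_1,\dots,p_n)\sim f(q_1,\dots,q_n)$; 2. for all $W\subseteq\mathit{Var}$ and all recursive specifications $S,S':W\to\mathbb{T}(\Sigma,W)$: if $S_Y[\sigma]\sim S'_Y[\sigma]$ for all $Y\in W$ and all $\sigma:W\to\mathsf{T}(\Sigma)$, then $\langle X|S\rangle\sim\langle X|S'\rangle$ for all $X\in W$. -/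

import Mathlib

universe u v w

namespace SOS

/-- A signature: a collection of function declarations, each with a finite arity. -/
structure Signature where
  Decl : Type v
  arity : Decl → ℕ

/-- `Term Sg Var W` is the set of terms with recursion over the signature `Sg` whose free
variables are drawn from `W`; names of bound variables are taken from `Var`.  So
`Term Sg Var Var` is the set of all (open) terms and `Term Sg Var PEmpty` the set of closed
terms.

In `fix V S X`, that is `⟨X|S⟩`, the set `V ⊆ Var` is the set of variables bound by the recursive
specification `S`.  An occurrence of a variable in the right-hand side `S Y` is tagged with `inr`
if this specification binds it and with `inl` if it refers to the surrounding scope.  Because the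
scope of each occurrence is recorded, substitution never captures a variable and needs no
renaming of bound variables. -/
inductive Term (Sg : Signature.{v}) (Var : Type u) : Type u → Type (max (u + 1) v)
  | var {W : Type u} (x : W) : Term Sg Var W
  | op {W : Type u} (f : Sg.Decl) (ts : Fin (Sg.arity f) → Term Sg Var W) : Term Sg Var W
  | fix {W : Type u} (V : Set Var) (S : V → Term Sg Var (W ⊕ V)) (X : V) : Term Sg Var W

/-- The closed terms (processes). -/
abbrev ClosedTerm (Sg : Signature.{v}) (Var : Type u) : Type (max (u + 1) v) :=
  Term Sg Var PEmpty.{u + 1}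

namespace Term

/-- The set of variables that occur free in a term. -/
def fv {Sg : Signature.{v}} {Var : Type u} : {W : Type u} → Term Sg Var W → Set W
  | _, var x => {x}
  | _, op _ ts => {x | ∃ i, x ∈ fv (ts i)}
  | _, fix _ S _ => {x | ∃ Y, Sum.inl x ∈ fv (S Y)}

/-- Replacement of free variables by variables. -/
def rename {Sg : Signature.{v}} {Var : Type u} :
    {W W' : Type u} → (W → W') → Term Sg Var W → Term Sg Var W'
  | _, _, g, var x => var (g x)
  | _, _, g, op f ts => op f (fun i => rename g (ts i))
  | _, _, g, fix V S X => fix V (fun Y => rename (Sum.map g id) (S Y)) X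

/-- A substitution extended to the scope of a recursive specification: the bound variables are
left alone. -/
def lift {Sg : Signature.{v}} {Var : Type u} {W W' : Type u} (V : Set Var)
    (σ : W → Term Sg Var W') : W ⊕ V → Term Sg Var (W' ⊕ V) :=
  Sum.elim (fun x => rename Sum.inl (σ x)) (fun Y => var (Sum.inr Y))

/-- The substitution instance `t[σ]`. -/
def subst {Sg : Signature.{v}} {Var : Type u} :
    {W W' : Type u} → (W → Term Sg Var W') → Term Sg Var W → Term Sg Var W'
  | _, _, σ, var x => σ x
  | _, _, σ, op f ts => op f (fun i => subst σ (ts i))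
  | _, _, σ, fix V S X => fix V (fun Y => subst (lift V σ) (S Y)) X

open Classical in
/-- The open term `⟨X|S⟩` for a recursive specification `S : V → 𝕋(Σ)` given by open terms: in the
right-hand sides exactly the free occurrences of the variables in `V` become bound. -/
noncomputable def mu {Sg : Signature.{v}} {Var : Type u} (V : Set Var)
    (S : V → Term Sg Var Var) (X : V) : Term Sg Var Var :=
  fix V (fun Y => rename (fun x => if h : x ∈ V then Sum.inr ⟨x, h⟩ else Sum.inl x) (S Y)) X

open Classical in
/-- `⟨t|S⟩`, that is `t[⟨Y|S⟩ / Y]` with `Y` ranging over the bound variables of `S`. -/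
noncomputable def muTerm {Sg : Signature.{v}} {Var : Type u} (V : Set Var)
    (S : V → Term Sg Var Var) (t : Term Sg Var Var) : Term Sg Var Var :=
  subst (fun y => if h : y ∈ V then mu V S ⟨y, h⟩ else var y) t

/-- The closed term `⟨X|S⟩` for a recursive specification `S : W → 𝕋(Σ, W)`, all of whose
variables are bound. -/
def closedMu {Sg : Signature.{v}} {Var : Type u} (W : Set Var) (S : W → Term Sg Var W) (X : W) :
    ClosedTerm Sg Var :=
  fix W (fun Y => rename Sum.inr (S Y)) X

/-- A closed term regarded as an open term. -/
def toOpen {Sg : Signature.{v}} {Var : Type u} (p : ClosedTerm Sg Var) : Term Sg Var Var :=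
  rename PEmpty.elim p

end Term

/-- Literals `t -a→ t'` and `t -a↛`. -/
inductive Literal (Sg : Signature.{v}) (Var : Type u) (A : Type w) : Type (max (u + 1) v w)
  | pos (t : Term Sg Var Var) (a : A) (t' : Term Sg Var Var) : Literal Sg Var A
  | neg (t : Term Sg Var Var) (a : A) : Literal Sg Var A

/-- Substitution instances of literals. -/
def Literal.subst {Sg : Signature.{v}} {Var : Type u} {A : Type w}
    (σ : Var → Term Sg Var Var) : Literal Sg Var A → Literal Sg Var A
  | .pos t a t' => .pos (t.subst σ) a (t'.subst σ)
  | .neg t a => .neg (t.subst σ) a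

/-- A transition rule: a set of premises and the conclusion `source -label→ target`. -/
structure Rule (Sg : Signature.{v}) (Var : Type u) (A : Type w) where
  premises : Set (Literal Sg Var A)
  source : Term Sg Var Var
  label : A
  target : Term Sg Var Var

/-- The conclusion of a rule. -/
def Rule.conclusion {Sg : Signature.{v}} {Var : Type u} {A : Type w} (r : Rule Sg Var A) :
    Literal Sg Var A :=
  .pos r.source r.label r.target

/-- A transition system specification over `Sg`, given by its set of rules. -/
structure TSS (Sg : Signature.{v}) (Var : Type u) (A : Type w) where
  rules : Set (Rule Sg Var A)

/-- A two-valued transition relation on processes. -/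
abbrev TransRel (Sg : Signature.{v}) (Var : Type u) (A : Type w) : Type (max (u + 1) v w) :=
  ClosedTerm Sg Var → A → ClosedTerm Sg Var → Prop

/-- `Provable P H β`: there is a proof of `H / β` from `P`, i.e. a well-founded (possibly
infinitely branching) tree of literals in which each node is a hypothesis without children, or
forms together with its children a substitution instance of a rule. -/
inductive Provable {Sg : Signature.{v}} {Var : Type u} {A : Type w} (P : TSS Sg Var A)
    (H : Set (Literal Sg Var A)) : Literal Sg Var A → Prop
  | hyp (β : Literal Sg Var A) (hβ : β ∈ H) : Provable P H β
  | rule (r : Rule Sg Var A) (hr : r ∈ P.rules) (σ : Var → Term Sg Var Var)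
      (hprem : ∀ β ∈ r.premises, Provable P H (β.subst σ)) :
      Provable P H (r.conclusion.subst σ)

/-- The closed negative literals that do not deny any transition in `T`. -/
def undenied {Sg : Signature.{v}} {Var : Type u} {A : Type w} (T : TransRel Sg Var A) :
    Set (Literal Sg Var A) :=
  {β | ∃ (p : ClosedTerm Sg Var) (a : A), β = .neg p.toOpen a ∧ ∀ q, ¬ T p a q}

namespace TSS

/-- The closed transitions that are provable from the hypotheses `N`. -/
def derived {Sg : Signature.{v}} {Var : Type u} {A : Type w} (P : TSS Sg Var A)
    (N : Set (Literal Sg Var A)) : TransRel Sg Var A :=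
  fun p a q => Provable P N (.pos p.toOpen a q.toOpen)

/-- The under-approximation `CT⁺_l`.  Reading the nested term from the inside, one finds
`PT⁻_l`, `PT⁺_l`, `CT⁻_l` and `CT⁺_l`. -/
def ctAt {Sg : Signature.{v}} {Var : Type u} {A : Type w} (P : TSS Sg Var A)
    (l : Ordinal.{max (u + 1) v w}) : TransRel Sg Var A :=
  P.derived (undenied (P.derived (undenied (fun p a q => ∃ k, ∃ _ : k < l, ctAt P k p a q))))
termination_by l

/-- The over-approximation `PT⁺_l`. -/
def ptAt {Sg : Signature.{v}} {Var : Type u} {A : Type w} (P : TSS Sg Var A)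
    (l : Ordinal.{max (u + 1) v w}) : TransRel Sg Var A :=
  P.derived (undenied (fun p a q => ∃ k < l, P.ctAt k p a q))

/-- The certain transitions of the well-founded semantics.  As `ctAt` increases and `ptAt`
decreases with the ordinal, the union and the intersection below are the values at the closure
ordinal. -/
def Certain {Sg : Signature.{v}} {Var : Type u} {A : Type w} (P : TSS Sg Var A) :
    TransRel Sg Var A :=
  fun p a q => ∃ l, P.ctAt l p a q

/-- The possible transitions of the well-founded semantics. -/
def Possible {Sg : Signature.{v}} {Var : Type u} {A : Type w} (P : TSS Sg Var A) :
    TransRel Sg Var A :=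
  fun p a q => ∀ l, P.ptAt l p a q

/-- Bisimulations on the three-valued transition system of `P`. -/
def IsBisimulation {Sg : Signature.{v}} {Var : Type u} {A : Type w} (P : TSS Sg Var A)
    (R : ClosedTerm Sg Var → ClosedTerm Sg Var → Prop) : Prop :=
  ∀ p q, R p q → ∀ a,
    (∀ p', P.Certain p a p' → ∃ q', P.Certain q a q' ∧ R p' q') ∧
    (∀ q', P.Possible q a q' → ∃ p', P.Possible p a p' ∧ R p' q')

/-- The bisimulation preorder `p ⊑_B q`, also called bisimilarity. -/
def BisimLE {Sg : Signature.{v}} {Var : Type u} {A : Type w} (P : TSS Sg Var A)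
    (p q : ClosedTerm Sg Var) : Prop :=
  ∃ R : ClosedTerm Sg Var → ClosedTerm Sg Var → Prop, P.IsBisimulation R ∧ R p q

/-- Bisimulation equivalence `p ≡_B q`: the kernel of the bisimulation preorder. -/
def BisimEquiv {Sg : Signature.{v}} {Var : Type u} {A : Type w} (P : TSS Sg Var A)
    (p q : ClosedTerm Sg Var) : Prop :=
  P.BisimLE p q ∧ P.BisimLE q p

end TSS

namespace Rule

/-- The right-hand sides of the positive premises are variables that are all distinct and that do
not occur in the source. -/
def IsNtytt {Sg : Signature.{v}} {Var : Type u} {A : Type w} (r : Rule Sg Var A) : Prop :=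
  (∀ t a t', Literal.pos t a t' ∈ r.premises → ∃ y, t' = .var y ∧ y ∉ r.source.fv) ∧
  (∀ t₁ a₁ t₂ a₂ t', Literal.pos t₁ a₁ t' ∈ r.premises → Literal.pos t₂ a₂ t' ∈ r.premises →
    t₁ = t₂ ∧ a₁ = a₂)

/-- An ntytt rule whose source is a variable. -/
def IsNtyxt {Sg : Signature.{v}} {Var : Type u} {A : Type w} (r : Rule Sg Var A) : Prop :=
  r.IsNtytt ∧ ∃ x, r.source = .var x

/-- An ntytt rule with source `f(x₁,…,xₙ)`, the `xᵢ` being distinct variables. -/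
def IsNtyft {Sg : Signature.{v}} {Var : Type u} {A : Type w} (r : Rule Sg Var A) : Prop :=
  r.IsNtytt ∧ ∃ (f : Sg.Decl) (x : Fin (Sg.arity f) → Var),
    Function.Injective x ∧ r.source = .op f (fun i => .var (x i))

/-- The recursion rule with premise `⟨S_X|S⟩ -a→ z` and conclusion `⟨X|S⟩ -a→ z`. -/
noncomputable def recursion {Sg : Signature.{v}} {Var : Type u} {A : Type w} (V : Set Var)
    (S : V → Term Sg Var Var) (X : V) (a : A) (z : Var) : Rule Sg Var A where
  premises := {.pos (Term.muTerm V S (S X)) a (.var z)}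
  source := Term.mu V S X
  label := a
  target := .var z

end Rule

namespace TSS

/-- A TSS is positive if it has no negative premises. -/
def IsPositive {Sg : Signature.{v}} {Var : Type u} {A : Type w} (P : TSS Sg Var A) : Prop :=
  ∀ r ∈ P.rules, ∀ t a, Literal.neg t a ∉ r.premises

/-- The ntyft/ntyxt format with recursion: for all `S`, `X` and `a` there is a recursion rule, whose
variable `z` is fresh, and all other rules are ntyft or ntyxt rules. -/
def IsNtyftNtyxtWithRecursion {Sg : Signature.{v}} {Var : Type u} {A : Type w}
    (P : TSS Sg Var A) : Prop :=
  (∀ (V : Set Var) (S : V → Term Sg Var Var) (X : V) (a : A),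
    ∃ z, z ∉ (Term.mu V S X).fv ∧ Rule.recursion V S X a z ∈ P.rules) ∧
  (∀ r ∈ P.rules,
    (∃ (V : Set Var) (S : V → Term Sg Var Var) (X : V) (a : A) (z : Var),
      z ∉ (Term.mu V S X).fv ∧ r = Rule.recursion V S X a z) ∨ r.IsNtyft ∨ r.IsNtyxt)

/-- The tyft/tyxt format with recursion: no negative premises. -/
def IsTyftTyxtWithRecursion {Sg : Signature.{v}} {Var : Type u} {A : Type w}
    (P : TSS Sg Var A) : Prop :=
  P.IsPositive ∧ P.IsNtyftNtyxtWithRecursion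

end TSS

/-- Full precongruences: preorders on processes that are preserved by all operators and by
replacing the right-hand sides of recursive specifications `S : W → 𝕋(Σ, W)` by right-hand sides
that are related under all closed substitutions. -/
structure IsFullPrecongruence {Sg : Signature.{v}} {Var : Type u}
    (R : ClosedTerm Sg Var → ClosedTerm Sg Var → Prop) : Prop where
  refl : ∀ p, R p p
  trans : ∀ p q r, R p q → R q r → R p r
  op : ∀ (f : Sg.Decl) (p q : Fin (Sg.arity f) → ClosedTerm Sg Var),
    (∀ i, R (p i) (q i)) → R (.op f p) (.op f q)
  recursion : ∀ (W : Set Var) (S S' : W → Term Sg Var W),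
    (∀ (Y : W) (σ : W → ClosedTerm Sg Var), R ((S Y).subst σ) ((S' Y).subst σ)) →
    ∀ X : W, R (Term.closedMu W S X) (Term.closedMu W S' X)

/-- Full congruences: symmetric full precongruences. -/
structure IsFullCongruence {Sg : Signature.{v}} {Var : Type u}
    (R : ClosedTerm Sg Var → ClosedTerm Sg Var → Prop) : Prop extends IsFullPrecongruence R where
  symm : ∀ p q, R p q → R q p

end SOS

-- For positive `P`, both $CT$ and $PT$ consist of the transitions with a proof made of closed
-- literals (`Step`), so bisimulation becomes two-valued and bisimilarity symmetric. What remains is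
-- to carry a transition from one instance of a context to a related instance.
--
-- Atoms are placeholders with two closed readings, `l a` and `ρ a`. A transition `s -b→ s'` lifts
-- if every atom term read as `s` under `l` can be sent to one read as `s'`, so that the readings
-- under `ρ` form a `b`-transition. `TSS.Step.lifts` shows this by induction on the proof of the
-- transition, provided bare atoms can be handled.
--
-- The obstacle is that the premises of a rule may depend on each other circularly or along infinite
-- chains, so the values of the variables cannot be chosen one after another. They are obtained
-- together as a least fixed point. The atom terms with a fixed reading under `l`, ordered by
-- replacing closed subterms by atoms, form a chain-complete order whose bottom is the atom-free
-- term. Liftings are required to be monotone, which makes the fixed point exist and depend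
-- monotonically on the source (`exists_premise_solution`).
--
-- Two choices of atoms finish the proof. Bisimilar pairs give congruence for arbitrary contexts
-- (`bisimLE_value`), operators in particular. For recursion, the atoms are pairs `(t⟨S⟩, q)` with
-- `t⟨S'⟩ ∼ q`. If `t` is a variable `X`, the induction hypothesis for the unfolding `S_X⟨S⟩` leads
-- to `S_X⟨S'⟩`, and the assumption on `S` and `S'` leads on to `S'_X⟨S'⟩`.

universe z y

namespace SOS

/-! ### Substitution calculus for terms -/

namespace Term

variable {Sg : Signature.{v}} {Var : Type u} {W W' W'' : Type u}

theorem rename_rename (t : Term Sg Var W) : ∀ {W' W'' : Type u} (g : W → W') (h : W' → W''),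
    rename h (rename g t) = rename (h ∘ g) t := by
  induction t with
  | var x => intros; rfl
  | op f ts ih => intros; simp only [rename, ih]
  | fix V S X ih => intros; simp only [rename, ih, Sum.map_comp_map, Function.id_comp]

theorem lift_comp_map (V : Set Var) (g : W → W') (σ : W' → Term Sg Var W'') :
    lift V σ ∘ Sum.map g id = lift V (σ ∘ g) := by
  funext x; cases x <;> rfl

theorem subst_rename (t : Term Sg Var W) : ∀ {W' W'' : Type u} (g : W → W')
    (σ : W' → Term Sg Var W''), subst σ (rename g t) = subst (σ ∘ g) t := by
  induction t with
  | var x => intros; rfl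
  | op f ts ih => intros; simp only [rename, subst, ih]
  | fix V S X ih => intros; simp only [rename, subst, ih, lift_comp_map]

theorem rename_comp_lift (V : Set Var) (σ : W → Term Sg Var W') (g : W' → W'') :
    rename (Sum.map g id) ∘ lift V σ = lift V (rename g ∘ σ) := by
  funext x
  cases x with
  | inl x => simp only [Function.comp_apply, lift, Sum.elim_inl, rename_rename]; rfl
  | inr x => rfl

theorem rename_subst (t : Term Sg Var W) : ∀ {W' W'' : Type u} (σ : W → Term Sg Var W')
    (g : W' → W''), rename g (subst σ t) = subst (rename g ∘ σ) t := by
  induction t with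
  | var x => intros; rfl
  | op f ts ih => intros; simp only [rename, subst, ih]
  | fix V S X ih => intros; simp only [rename, subst, ih, rename_comp_lift]

theorem subst_comp_lift (V : Set Var) (σ : W → Term Sg Var W') (τ : W' → Term Sg Var W'') :
    subst (lift V τ) ∘ lift V σ = lift V (subst τ ∘ σ) := by
  funext x
  cases x with
  | inl x =>
    simp only [Function.comp_apply, lift, Sum.elim_inl, subst_rename, rename_subst]; rfl
  | inr x => rfl

theorem subst_subst (t : Term Sg Var W) : ∀ {W' W'' : Type u} (σ : W → Term Sg Var W')
    (τ : W' → Term Sg Var W''), subst τ (subst σ t) = subst (subst τ ∘ σ) t := by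
  induction t with
  | var x => intros; rfl
  | op f ts ih => intros; simp only [subst, ih]
  | fix V S X ih => intros; simp only [subst, ih, subst_comp_lift]

theorem lift_var (V : Set Var) :
    lift V (var : W → Term Sg Var W) = var := by
  funext x; cases x <;> rfl

theorem subst_var (t : Term Sg Var W) : subst var t = t := by
  induction t with
  | var x => rfl
  | op f ts ih => simp only [subst, ih]
  | fix V S X ih => simp only [subst, lift_var, ih]

theorem rename_eq_subst (t : Term Sg Var W) (g : W → W') : rename g t = subst (var ∘ g) t := by
  rw [← subst_var (rename g t), subst_rename]

theorem subst_closed (p : ClosedTerm Sg Var) (σ : PEmpty → ClosedTerm Sg Var) :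
    subst σ p = p := by
  rw [show σ = var from funext fun x => x.elim, subst_var]

theorem subst_rename_closed (p : ClosedTerm Sg Var) (g : PEmpty → W)
    (σ : W → ClosedTerm Sg Var) : subst σ (rename g p) = p := by
  rw [subst_rename, subst_closed]

theorem rename_closed (p : ClosedTerm Sg Var) (g : PEmpty → PEmpty) : rename g p = p := by
  rw [rename_eq_subst, subst_closed]

/-- A closed term in the scope `W`. -/
def weaken (p : ClosedTerm Sg Var) : Term Sg Var W := rename PEmpty.elim p

theorem rename_weaken (p : ClosedTerm Sg Var) (g : W → W') :
    rename g (weaken p) = weaken p := by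
  rw [weaken, rename_rename, weaken]; congr 1; funext x; exact x.elim

theorem subst_weaken (p : ClosedTerm Sg Var) (σ : W → Term Sg Var W') :
    subst σ (weaken p) = weaken p := by
  rw [weaken, subst_rename, weaken, rename_eq_subst]; congr 1; funext x; exact x.elim

theorem weaken_closed (p : ClosedTerm Sg Var) : (weaken p : ClosedTerm Sg Var) = p :=
  rename_closed p _

/-- The unfolding `⟨S_X|S⟩` of the closed term `⟨X|S⟩`. -/
def unfold (V : Set Var) (S : V → Term Sg Var (PEmpty ⊕ V)) (X : V) : ClosedTerm Sg Var :=
  subst (Sum.elim PEmpty.elim (fix V S)) (S X)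

end Term

/-! ### Terms with atoms and their readings -/

/-- Terms with additional leaves, the atoms, which stand for closed terms. -/
inductive AtomTerm (Sg : Signature.{v}) (Var : Type u) (α : Type z) :
    Type u → Type (max (u + 1) v z)
  | atom {W : Type u} (a : α) : AtomTerm Sg Var α W
  | var {W : Type u} (x : W) : AtomTerm Sg Var α W
  | op {W : Type u} (f : Sg.Decl) (ts : Fin (Sg.arity f) → AtomTerm Sg Var α W) :
      AtomTerm Sg Var α W
  | fix {W : Type u} (V : Set Var) (S : V → AtomTerm Sg Var α (W ⊕ V)) (X : V) :
      AtomTerm Sg Var α W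

namespace AtomTerm

variable {Sg : Signature.{v}} {Var : Type u} {α : Type z} {W W' W'' : Type u}

/-- An ordinary term, as a term without atoms. -/
def ofTerm : {W : Type u} → Term Sg Var W → AtomTerm Sg Var α W
  | _, .var x => var x
  | _, .op f ts => op f (fun i => ofTerm (ts i))
  | _, .fix V S X => fix V (fun Y => ofTerm (S Y)) X

/-- Replacement of free variables by variables. -/
def rename : {W W' : Type u} → (W → W') → AtomTerm Sg Var α W → AtomTerm Sg Var α W'
  | _, _, _, atom a => atom a
  | _, _, g, var x => var (g x)
  | _, _, g, op f ts => op f (fun i => rename g (ts i))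
  | _, _, g, fix V S X => fix V (fun Y => rename (Sum.map g id) (S Y)) X

/-- A substitution extended to the scope of a recursive specification. -/
def lift (V : Set Var) (σ : W → AtomTerm Sg Var α W') : W ⊕ V → AtomTerm Sg Var α (W' ⊕ V) :=
  Sum.elim (fun x => rename Sum.inl (σ x)) (fun Y => var (Sum.inr Y))

/-- Substitution for variables. -/
def subst : {W W' : Type u} → (W → AtomTerm Sg Var α W') → AtomTerm Sg Var α W →
    AtomTerm Sg Var α W'
  | _, _, _, atom a => atom a
  | _, _, σ, var x => σ x
  | _, _, σ, op f ts => op f (fun i => subst σ (ts i))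
  | _, _, σ, fix V S X => fix V (fun Y => subst (lift V σ) (S Y)) X

/-- Replacement of the atoms by terms. -/
def eval : {W : Type u} → (α → Term Sg Var W) → AtomTerm Sg Var α W → Term Sg Var W
  | _, g, atom a => g a
  | _, _, var x => .var x
  | _, g, op f ts => .op f (fun i => eval g (ts i))
  | _, g, fix V S X => .fix V (fun Y => eval (fun a => (g a).rename Sum.inl) (S Y)) X

/-- Replacement of the atoms by closed terms. -/
def value (l : α → ClosedTerm Sg Var) (m : AtomTerm Sg Var α W) : Term Sg Var W :=
  eval (fun a => (l a).weaken) m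

theorem value_fix (l : α → ClosedTerm Sg Var) (V : Set Var)
    (S : V → AtomTerm Sg Var α (W ⊕ V)) (X : V) :
    value l (fix V S X) = .fix V (fun Y => value l (S Y)) X := by
  simp only [value, eval, Term.rename_weaken]

theorem value_op (l : α → ClosedTerm Sg Var) (f : Sg.Decl)
    (ts : Fin (Sg.arity f) → AtomTerm Sg Var α W) :
    value l (op f ts) = .op f (fun i => value l (ts i)) := rfl

theorem value_atom (l : α → ClosedTerm Sg Var) (a : α) :
    value l (atom a : AtomTerm Sg Var α W) = (l a).weaken := rfl

theorem eval_ofTerm (t : Term Sg Var W) : ∀ g : α → Term Sg Var W, eval g (ofTerm t) = t := by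
  induction t with
  | var x => intros; rfl
  | op f ts ih => intros; simp only [ofTerm, eval, ih]
  | fix V S X ih => intros; simp only [ofTerm, eval, ih]

theorem value_ofTerm (l : α → ClosedTerm Sg Var) (t : Term Sg Var W) :
    value l (ofTerm t) = t :=
  eval_ofTerm t _

theorem eval_rename (m : AtomTerm Sg Var α W) : ∀ {W' : Type u} (h : W → W')
    (g : α → Term Sg Var W),
    eval (fun a => (g a).rename h) (rename h m) = (eval g m).rename h := by
  induction m with
  | atom a => intros; rfl
  | var x => intros; rfl
  | op f ts ih => intros; simp only [rename, eval, Term.rename, ih]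
  | fix V S X ih =>
    intro W' h g
    simp only [rename, eval, Term.rename, ← ih, Term.rename_rename]
    rfl

theorem value_rename (l : α → ClosedTerm Sg Var) (m : AtomTerm Sg Var α W) (h : W → W') :
    value l (rename h m) = (value l m).rename h := by
  simp only [value, ← eval_rename, Term.rename_weaken]

theorem value_comp_lift (l : α → ClosedTerm Sg Var) (V : Set Var)
    (σ : W → AtomTerm Sg Var α W') :
    (fun x => value l (lift V σ x)) = Term.lift V (fun x => value l (σ x)) := by
  funext x
  cases x with
  | inl x => simp only [lift, Term.lift, Sum.elim_inl, value_rename]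
  | inr x => rfl

theorem value_subst (l : α → ClosedTerm Sg Var) (m : AtomTerm Sg Var α W) :
    ∀ {W' : Type u} (σ : W → AtomTerm Sg Var α W'),
    value l (subst σ m) = (value l m).subst (fun x => value l (σ x)) := by
  induction m with
  | atom a => intros; simp only [subst, value_atom, Term.subst_weaken]
  | var x => intros; rfl
  | op f ts ih => intros; simp only [subst, value_op, Term.subst, ih]
  | fix V S X ih => intros; simp only [subst, value_fix, Term.subst, ih, value_comp_lift]

theorem value_ofTerm_subst (l : α → ClosedTerm Sg Var) (t : Term Sg Var W)
    (σ : W → AtomTerm Sg Var α W') :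
    value l (subst σ (ofTerm t)) = t.subst (fun x => value l (σ x)) := by
  rw [value_subst, value_ofTerm]

theorem lift_comp_map (V : Set Var) (g : W → W') (σ : W' → AtomTerm Sg Var α W'') :
    lift V σ ∘ Sum.map g id = lift V (σ ∘ g) := by
  funext x; cases x <;> rfl

theorem subst_rename (m : AtomTerm Sg Var α W) : ∀ {W' W'' : Type u} (g : W → W')
    (σ : W' → AtomTerm Sg Var α W''), subst σ (rename g m) = subst (σ ∘ g) m := by
  induction m with
  | atom a => intros; rfl
  | var x => intros; rfl
  | op f ts ih => intros; simp only [rename, subst, ih]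
  | fix V S X ih => intros; simp only [rename, subst, ih, lift_comp_map]

theorem ofTerm_rename (t : Term Sg Var W) : ∀ {W' : Type u} (g : W → W'),
    (ofTerm (t.rename g) : AtomTerm Sg Var α W') = rename g (ofTerm t) := by
  induction t with
  | var x => intros; rfl
  | op f ts ih => intros; simp only [rename, ofTerm, Term.rename, ih]
  | fix V S X ih => intros; simp only [rename, ofTerm, Term.rename, ih]

theorem lift_ofTerm (V : Set Var) (σ : W → Term Sg Var W') :
    lift V (fun x => (ofTerm (σ x) : AtomTerm Sg Var α W')) =
      fun x => ofTerm (Term.lift V σ x) := by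
  funext x
  cases x with
  | inl x => simp only [lift, Term.lift, Sum.elim_inl, ofTerm_rename]
  | inr x => rfl

theorem ofTerm_subst (t : Term Sg Var W) : ∀ {W' : Type u} (σ : W → Term Sg Var W'),
    (ofTerm (t.subst σ) : AtomTerm Sg Var α W') = subst (fun x => ofTerm (σ x)) (ofTerm t) := by
  induction t with
  | var x => intros; rfl
  | op f ts ih => intros; simp only [subst, ofTerm, Term.subst, ih]
  | fix V S X ih => intros; simp only [subst, ofTerm, Term.subst, ih, lift_ofTerm]

theorem subst_ofTerm_weaken (p : ClosedTerm Sg Var) (σ : W → AtomTerm Sg Var α W') :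
    subst σ (ofTerm p.weaken) = ofTerm p.weaken := by
  conv_lhs => rw [Term.weaken, ofTerm_rename, subst_rename]
  rw [Term.weaken, Term.rename_eq_subst, ofTerm_subst]
  congr 1; funext x; exact x.elim

theorem subst_eval (m : AtomTerm Sg Var α W) : ∀ {W' : Type u} (σ : W → Term Sg Var W')
    (g : α → Term Sg Var W),
    (eval g m).subst σ = eval (fun a => (g a).subst σ) (m.subst (fun x => ofTerm (σ x))) := by
  induction m with
  | atom a => intros; rfl
  | var x => intros; simp only [eval, subst, Term.subst, eval_ofTerm]
  | op f ts ih => intros; simp only [subst, eval, Term.subst, ih]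
  | fix V S X ih =>
    intros
    simp only [subst, eval, Term.subst, ih, lift_ofTerm, Term.subst_rename, Term.rename_subst]
    rfl

/-- A term with atoms that are instances of terms over `W` is an instance of a term over `W`. -/
theorem subst_eval_rename (m : AtomTerm Sg Var α PEmpty) (g : α → Term Sg Var W)
    (σ : W → ClosedTerm Sg Var) :
    (eval g (rename PEmpty.elim m)).subst σ = value (fun a => (g a).subst σ) m := by
  rw [subst_eval, subst_rename]
  trans value (fun a => (g a).subst σ) (m.subst ((fun x => ofTerm (σ x)) ∘ PEmpty.elim))
  · simp only [value, Term.weaken_closed]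
  · rw [value_subst, Term.subst_closed]

/-- Replacement of the atoms by other atoms. -/
def map {β : Type y} (φ : α → β) : {W : Type u} → AtomTerm Sg Var α W → AtomTerm Sg Var β W
  | _, atom a => atom (φ a)
  | _, var x => var x
  | _, op f ts => op f (fun i => map φ (ts i))
  | _, fix V S X => fix V (fun Y => map φ (S Y)) X

theorem value_map {β : Type y} (φ : α → β) (l : β → ClosedTerm Sg Var)
    (m : AtomTerm Sg Var α W) : value l (map φ m) = value (fun a => l (φ a)) m := by
  induction m with
  | atom a => rfl
  | var x => rfl
  | op f ts ih => simp only [map, value_op, ih]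
  | fix V S X ih => simp only [map, value_fix, ih]

/-! ### The order that introduces atoms -/

/-- `Le l m n`: `n` arises from `m` by replacing closed subterms without atoms by atoms, where an
atom `a` may replace the closed term `l a`. -/
def Le (l : α → ClosedTerm Sg Var) : {W : Type u} → AtomTerm Sg Var α W →
    AtomTerm Sg Var α W → Prop
  | _, m, atom a => m = atom a ∨ m = ofTerm (l a).weaken
  | _, m, var x => m = var x
  | _, m, op f ts => ∃ ts', m = op f ts' ∧ ∀ i, Le l (ts' i) (ts i)
  | _, m, fix V S X => ∃ S', m = fix V S' X ∧ ∀ Y, Le l (S' Y) (S Y)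

variable {l : α → ClosedTerm Sg Var}

theorem Le.op {f : Sg.Decl} {ts ts' : Fin (Sg.arity f) → AtomTerm Sg Var α W}
    (h : ∀ i, Le l (ts i) (ts' i)) : Le l (op f ts) (op f ts') :=
  ⟨ts, rfl, h⟩

theorem Le.fix {V : Set Var} {S S' : V → AtomTerm Sg Var α (W ⊕ V)} {X : V}
    (h : ∀ Y, Le l (S Y) (S' Y)) : Le l (fix V S X) (fix V S' X) :=
  ⟨S, rfl, h⟩

theorem Le.op_iff {f : Sg.Decl} {ts ts' : Fin (Sg.arity f) → AtomTerm Sg Var α W} :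
    Le l (AtomTerm.op f ts) (AtomTerm.op f ts') ↔ ∀ i, Le l (ts i) (ts' i) := by
  refine ⟨?_, Le.op⟩
  rintro ⟨ts'', h, h'⟩
  cases h
  exact h'

theorem Le.fix_iff {V : Set Var} {S S' : V → AtomTerm Sg Var α (W ⊕ V)} {X : V} :
    Le l (AtomTerm.fix V S X) (AtomTerm.fix V S' X) ↔ ∀ Y, Le l (S Y) (S' Y) := by
  refine ⟨?_, Le.fix⟩
  rintro ⟨ts'', h, h'⟩
  cases h
  exact h'

theorem Le.refl (m : AtomTerm Sg Var α W) : Le l m m := by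
  induction m with
  | atom a => exact Or.inl rfl
  | var x => exact Eq.refl _
  | op f ts ih => exact Le.op ih
  | fix V S X ih => exact Le.fix ih

theorem Le.ofTerm_value (m : AtomTerm Sg Var α W) : Le l (ofTerm (value l m)) m := by
  induction m with
  | atom a => exact Or.inr rfl
  | var x => exact Eq.refl _
  | op f ts ih => exact Le.op ih
  | fix V S X ih => rw [value_fix]; exact Le.fix ih

theorem Le.eq_ofTerm (t : Term Sg Var W) : ∀ {m : AtomTerm Sg Var α W},
    Le l m (ofTerm t) → m = ofTerm t := by
  induction t with
  | var x => exact fun h => h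
  | op f ts ih => exact fun ⟨ts', e, h⟩ => e.trans (congrArg (AtomTerm.op f) (funext fun i => ih i (h i)))
  | fix V S X ih =>
    exact fun ⟨S', e, h⟩ => e.trans (congrArg (AtomTerm.fix V · X) (funext fun Y => ih Y (h Y)))

theorem Le.trans (o : AtomTerm Sg Var α W) : ∀ {m n}, Le l m n → Le l n o → Le l m o := by
  induction o with
  | atom a =>
    rintro m n h (rfl | rfl)
    · exact h
    · exact Or.inr (Le.eq_ofTerm _ h)
  | var x => rintro m n h ⟨⟩; exact h
  | op f ts ih =>
    rintro m n h ⟨ts', rfl, h'⟩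
    obtain ⟨ts'', rfl, h''⟩ := h
    exact Le.op fun i => ih i (h'' i) (h' i)
  | fix V S X ih =>
    rintro m n h ⟨S', rfl, h'⟩
    obtain ⟨S'', rfl, h''⟩ := h
    exact Le.fix fun i => ih i (h'' i) (h' i)

theorem Le.antisymm (n : AtomTerm Sg Var α W) : ∀ {m}, Le l m n → Le l n m → m = n := by
  induction n with
  | atom a =>
    rintro m (rfl | rfl) h'
    · rfl
    · exact (Le.eq_ofTerm _ h').symm
  | var x => rintro m ⟨⟩ _; rfl
  | op f ts ih =>
    rintro m ⟨ts', rfl, h⟩ h'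
    exact congrArg (AtomTerm.op f) (funext fun i => ih i (h i) (Le.op_iff.1 h' i))
  | fix V S X ih =>
    rintro m ⟨S', rfl, h⟩ h'
    exact congrArg (AtomTerm.fix V · X) (funext fun Y => ih Y (h Y) (Le.fix_iff.1 h' Y))

theorem Le.rename (n : AtomTerm Sg Var α W) : ∀ {m} {W' : Type u} (g : W → W'),
    Le l m n → Le l (m.rename g) (n.rename g) := by
  induction n with
  | atom a =>
    rintro m W' g (rfl | rfl)
    · exact Or.inl rfl
    · rw [← ofTerm_rename, Term.rename_weaken]; exact Or.inr rfl
  | var x => rintro m W' g ⟨⟩; exact Le.refl _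
  | op f ts ih => rintro m W' g ⟨ts', rfl, h⟩; exact Le.op fun i => ih i g (h i)
  | fix V S X ih => rintro m W' g ⟨S', rfl, h⟩; exact Le.fix fun i => ih i _ (h i)

theorem Le.lift (V : Set Var) {σ τ : W → AtomTerm Sg Var α W'} (h : ∀ x, Le l (σ x) (τ x)) :
    ∀ x, Le l (lift V σ x) (lift V τ x)
  | .inl x => Le.rename _ _ (h x)
  | .inr _ => Le.refl _

theorem Le.subst (n : AtomTerm Sg Var α W) : ∀ {m} {W' : Type u}
    {σ τ : W → AtomTerm Sg Var α W'}, (∀ x, Le l (σ x) (τ x)) →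
    Le l m n → Le l (m.subst σ) (n.subst τ) := by
  induction n with
  | atom a =>
    rintro m W' σ τ hσ (rfl | rfl)
    · exact Or.inl rfl
    · rw [subst_ofTerm_weaken]; exact Or.inr rfl
  | var x => rintro m W' σ τ hσ ⟨⟩; exact hσ x
  | op f ts ih => rintro m W' σ τ hσ ⟨ts', rfl, h⟩; exact Le.op fun i => ih i hσ (h i)
  | fix V S X ih =>
    rintro m W' σ τ hσ ⟨S', rfl, h⟩
    exact Le.fix fun i => ih i (Le.lift V hσ) (h i)

end AtomTerm

/-! ### Fixed points and chain completeness -/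

/-- Least fixed points of monotone functions on chain-complete partial orders. -/
theorem exists_least_fixedPoint {α : Type z} [PartialOrder α]
    (hα : ∀ c : Set α, IsChain (· ≤ ·) c → ∃ x, IsLUB c x) (f : α → α) (hf : Monotone f) :
    ∃ x, f x = x ∧ ∀ y, f y ≤ y → x ≤ y := by
  -- `D` is the least set closed under `f` and under suprema of chains. It has a maximal element,
  -- which is fixed because `x ≤ f x` throughout `D`.
  let D : Set α := {x | ∀ E : Set α, (∀ y ∈ E, f y ∈ E) →
    (∀ c ⊆ E, IsChain (· ≤ ·) c → ∀ y, IsLUB c y → y ∈ E) → x ∈ E}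
  have hD : ∀ x ∈ D, f x ∈ D := fun x hx E h₁ h₂ => h₁ x (hx E h₁ h₂)
  have hD' : ∀ c ⊆ D, IsChain (· ≤ ·) c → ∀ y, IsLUB c y → y ∈ D := fun c hc hc' y hy E h₁ h₂ =>
    h₂ c (fun x hx => hc hx E h₁ h₂) hc' y hy
  obtain ⟨x, hx⟩ := zorn_le₀ D fun c hc hc' => by
    obtain ⟨y, hy⟩ := hα c hc'
    exact ⟨y, hD' c hc hc' y hy, hy.1⟩
  have hle : x ≤ f x := hx.1 {x | x ≤ f x} (fun y hy => hf hy)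
    fun c hc _ y hy => hy.2 fun z hz => (hc hz).trans (hf (hy.1 hz))
  refine ⟨x, le_antisymm (hx.2 (hD x hx.1) hle) hle, fun y hy => ?_⟩
  exact hx.1 {x | x ≤ y} (fun z hz => (hf hz).trans hy) fun c hc _ z hz => hz.2 hc

namespace AtomTerm

variable {Sg : Signature.{v}} {Var : Type u} {α : Type z} {W : Type u}
  {l : α → ClosedTerm Sg Var}

theorem eq_op_of_value {m : AtomTerm Sg Var α W} {f : Sg.Decl}
    {ps : Fin (Sg.arity f) → Term Sg Var W} (h : value l m = .op f ps) :
    (∃ a, m = atom a) ∨ ∃ ms, m = op f ms ∧ ∀ i, value l (ms i) = ps i := by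
  cases m with
  | atom a => exact Or.inl ⟨a, rfl⟩
  | var x => cases h
  | op g ms => cases h; exact Or.inr ⟨ms, rfl, fun _ => rfl⟩
  | fix V S X => cases h

theorem eq_fix_of_value {m : AtomTerm Sg Var α W} {V : Set Var}
    {S : V → Term Sg Var (W ⊕ V)} {X : V} (h : value l m = .fix V S X) :
    (∃ a, m = atom a) ∨ ∃ S', m = fix V S' X ∧ ∀ Y, value l (S' Y) = S Y := by
  cases m with
  | atom a => exact Or.inl ⟨a, rfl⟩
  | var x => cases h
  | op g ms => cases h
  | fix V S' X => rw [value_fix] at h; cases h; exact Or.inr ⟨S', rfl, fun _ => rfl⟩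

theorem eq_var_of_value {m : AtomTerm Sg Var α W} {x : W} (h : value l m = .var x) :
    (∃ a, m = atom a) ∨ m = var x := by
  cases m with
  | atom a => exact Or.inl ⟨a, rfl⟩
  | var x => cases h; exact Or.inr rfl
  | op g ms => cases h
  | fix V S' X => cases h

/-- `IsLub l s C x`: `x` is the least upper bound of `C` among the terms with value `s`. -/
structure IsLub (l : α → ClosedTerm Sg Var) (s : Term Sg Var W) (C : Set (AtomTerm Sg Var α W))
    (x : AtomTerm Sg Var α W) : Prop where
  value_eq : value l x = s
  le : ∀ m ∈ C, Le l m x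
  least : ∀ z, value l z = s → (∀ m ∈ C, Le l m z) → Le l x z

/-- If an atom bounds a set of non-atoms, every member is the atom-free term. Then `ofTerm s` is
itself an upper bound, and it lies below the atom, so leastness need only be tested against
non-atoms. -/
theorem IsLub.of_ne_atom {s : Term Sg Var W} {C : Set (AtomTerm Sg Var α W)}
    {x : AtomTerm Sg Var α W} (hx : value l x = s) (hCx : ∀ m ∈ C, Le l m x)
    (hleast : ∀ z, value l z = s → (∀ m ∈ C, Le l m z) → (∀ a, z ≠ atom a) → Le l x z)
    (hs : ∀ a : α, ofTerm s ≠ (atom a : AtomTerm Sg Var α W)) (hC : ∀ m ∈ C, ∀ a, m ≠ atom a) :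
    IsLub l s C x := by
  refine ⟨hx, hCx, fun z hz hCz => ?_⟩
  by_cases h : ∃ a, z = atom a
  · obtain ⟨a, rfl⟩ := h
    refine Le.trans _ (hleast (ofTerm s) (value_ofTerm _ _) (fun m hm => ?_) hs) (Or.inr ?_)
    · rcases hCz m hm with h | h
      · exact absurd h (hC m hm a)
      · rw [h, ← hz]; exact Le.refl _
    · rw [← hz]; rfl
  · exact hleast z hz hCz fun a ha => h ⟨a, ha⟩

theorem ofTerm_ne_atom (t : Term Sg Var W) (a : α) : ofTerm t ≠ atom a := by
  cases t <;> simp [ofTerm]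

theorem Le.atom_left {a : α} {n : AtomTerm Sg Var α W} (h : Le l (atom a) n) : n = atom a := by
  cases n with
  | atom b => exact (h.resolve_right fun h => ofTerm_ne_atom _ _ h.symm).symm
  | var x => cases h
  | op f ts => obtain ⟨_, h, _⟩ := h; cases h
  | fix V S X => obtain ⟨_, h, _⟩ := h; cases h

/-- To find least upper bounds of chains it suffices to consider nonempty chains without atoms. -/
theorem exists_isLub_of_ne_atom {s : Term Sg Var W}
    (H : ∀ C : Set (AtomTerm Sg Var α W), C.Nonempty → (∀ m ∈ C, ∀ a, m ≠ atom a) →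
      (∀ m ∈ C, value l m = s) → (∀ m ∈ C, ∀ n ∈ C, Le l m n ∨ Le l n m) → ∃ x, IsLub l s C x)
    (C : Set (AtomTerm Sg Var α W)) (hs : ∀ m ∈ C, value l m = s)
    (hC : ∀ m ∈ C, ∀ n ∈ C, Le l m n ∨ Le l n m) : ∃ x, IsLub l s C x := by
  rcases C.eq_empty_or_nonempty with rfl | hne
  · refine ⟨ofTerm s, value_ofTerm _ _, by simp, ?_⟩
    rintro z rfl _
    exact Le.ofTerm_value z
  by_cases ha : ∃ a, atom a ∈ C
  · obtain ⟨a, ha⟩ := ha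
    -- Nothing else lies above an atom, so it is the greatest element of the chain.
    refine ⟨atom a, hs _ ha, fun m hm => ?_, fun z _ hz => hz _ ha⟩
    exact (hC m hm _ ha).elim id fun h => h.atom_left ▸ Le.refl _
  · exact H C hne (fun m hm a h => ha ⟨a, h ▸ hm⟩) hs hC

/-- Non-atoms with value `s` share the root of `s` and are compared componentwise, so bounds are
built by induction on `s`. -/
theorem exists_isLub (s : Term Sg Var W) : ∀ C : Set (AtomTerm Sg Var α W),
    (∀ m ∈ C, value l m = s) → (∀ m ∈ C, ∀ n ∈ C, Le l m n ∨ Le l n m) →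
    ∃ x, IsLub l s C x := by
  induction s with
  | var x =>
    refine exists_isLub_of_ne_atom fun C ⟨m₀, hm₀⟩ hna hs hC => ?_
    have hC' : ∀ m ∈ C, m = var x := fun m hm =>
      (eq_var_of_value (hs m hm)).resolve_left fun ⟨a, h⟩ => hna m hm a h
    exact ⟨var x, rfl, hC', fun z _ hz => hC' m₀ hm₀ ▸ hz m₀ hm₀⟩
  | op f ps ih =>
    refine exists_isLub_of_ne_atom fun C ⟨m₀, hm₀⟩ hna hs hC => ?_
    have hC' : ∀ m ∈ C, ∃ ms, m = op f ms ∧ ∀ i, value l (ms i) = ps i := fun m hm =>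
      (eq_op_of_value (hs m hm)).resolve_left fun ⟨a, h⟩ => hna m hm a h
    choose x hlub using fun i => ih i {m | ∃ ms, op f ms ∈ C ∧ m = ms i}
      (by
        rintro _ ⟨ms, hms, rfl⟩
        obtain ⟨ms', h, h'⟩ := hC' _ hms
        cases h; exact h' i)
      (by
        rintro _ ⟨ms, hms, rfl⟩ _ ⟨ms', hms', rfl⟩
        exact (hC _ hms _ hms').imp (fun h => Le.op_iff.1 h i) (fun h => Le.op_iff.1 h i))
    refine ⟨op f x, .of_ne_atom (by simp only [value_op, fun i => (hlub i).value_eq])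
      (fun m hm => ?_) (fun z hz hCz hza => ?_) (ofTerm_ne_atom _) hna⟩
    · obtain ⟨ms, rfl, _⟩ := hC' m hm
      exact Le.op fun i => (hlub i).le _ ⟨ms, hm, rfl⟩
    · obtain ⟨zs, rfl, hzs⟩ := (eq_op_of_value hz).resolve_left fun ⟨a, h⟩ => hza a h
      refine Le.op fun i => (hlub i).least _ (hzs i) ?_
      rintro _ ⟨ms, hms, rfl⟩
      exact Le.op_iff.1 (hCz _ hms) i
  | fix V S X ih =>
    refine exists_isLub_of_ne_atom fun C ⟨m₀, hm₀⟩ hna hs hC => ?_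
    have hC' : ∀ m ∈ C, ∃ ms, m = fix V ms X ∧ ∀ Y, value l (ms Y) = S Y := fun m hm =>
      (eq_fix_of_value (hs m hm)).resolve_left fun ⟨a, h⟩ => hna m hm a h
    choose x hlub using fun Y => ih Y {m | ∃ ms, fix V ms X ∈ C ∧ m = ms Y}
      (by
        rintro _ ⟨ms, hms, rfl⟩
        obtain ⟨ms', h, h'⟩ := hC' _ hms
        cases h; exact h' Y)
      (by
        rintro _ ⟨ms, hms, rfl⟩ _ ⟨ms', hms', rfl⟩
        exact (hC _ hms _ hms').imp (fun h => Le.fix_iff.1 h Y) (fun h => Le.fix_iff.1 h Y))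
    refine ⟨fix V x X, .of_ne_atom (by simp only [value_fix, fun i => (hlub i).value_eq])
      (fun m hm => ?_) (fun z hz hCz hza => ?_) (ofTerm_ne_atom _) hna⟩
    · obtain ⟨ms, rfl, _⟩ := hC' m hm
      exact Le.fix fun i => (hlub i).le _ ⟨ms, hm, rfl⟩
    · obtain ⟨zs, rfl, hzs⟩ := (eq_fix_of_value hz).resolve_left fun ⟨a, h⟩ => hza a h
      refine Le.fix fun i => (hlub i).least _ (hzs i) ?_
      rintro _ ⟨ms, hms, rfl⟩
      exact Le.fix_iff.1 (hCz _ hms) i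

end AtomTerm

/-- The closed terms with atoms that represent the closed term `s` if the atoms are read as
specified by `l`. -/
@[ext]
structure Fiber {Sg : Signature.{v}} {Var : Type u} {α : Type z} (l : α → ClosedTerm Sg Var)
    (s : ClosedTerm Sg Var) where
  val : AtomTerm Sg Var α PEmpty.{u + 1}
  value_eq : val.value l = s

namespace Fiber

variable {Sg : Signature.{v}} {Var : Type u} {α : Type z} {l : α → ClosedTerm Sg Var}
  {s : ClosedTerm Sg Var}

instance : PartialOrder (Fiber l s) where
  le m n := AtomTerm.Le l m.1 n.1
  le_refl m := AtomTerm.Le.refl _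
  le_trans _ _ _ := AtomTerm.Le.trans _
  le_antisymm _ _ h h' := Fiber.ext (AtomTerm.Le.antisymm _ h h')

theorem le_def {m n : Fiber l s} : m ≤ n ↔ AtomTerm.Le l m.1 n.1 := Iff.rfl

instance : OrderBot (Fiber l s) where
  bot := ⟨AtomTerm.ofTerm s, AtomTerm.value_ofTerm _ _⟩
  bot_le m := by
    have h := AtomTerm.Le.ofTerm_value (l := l) m.1
    rw [m.2] at h
    exact h

theorem coe_bot : (⊥ : Fiber l s).1 = AtomTerm.ofTerm s := rfl

theorem exists_isLUB (c : Set (Fiber l s)) (hc : IsChain (· ≤ ·) c) : ∃ x, IsLUB c x := by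
  obtain ⟨x, hx, h₁, h₂⟩ := AtomTerm.exists_isLub (l := l) s (Fiber.val '' c)
    (by rintro _ ⟨m, _, rfl⟩; exact m.2)
    (by rintro _ ⟨m, hm, rfl⟩ _ ⟨n, hn, rfl⟩; exact hc.total hm hn)
  refine ⟨⟨x, hx⟩, fun m hm => h₁ _ ⟨m, hm, rfl⟩, fun z hz => h₂ z.1 z.2 ?_⟩
  rintro _ ⟨m, hm, rfl⟩
  exact hz hm

theorem exists_isLUB_pi {ι : Type w} {p : ι → ClosedTerm Sg Var}
    (c : Set (∀ i, Fiber l (p i))) (hc : IsChain (· ≤ ·) c) : ∃ x, IsLUB c x := by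
  choose x hx using fun i : ι => exists_isLUB ((fun m : ∀ i, Fiber l (p i) => m i) '' c) (by
    rintro _ ⟨m, hm, rfl⟩ _ ⟨n, hn, rfl⟩ _
    exact (hc.total hm hn).imp (fun h => h i) (fun h => h i))
  exact ⟨x, isLUB_pi.2 hx⟩

end Fiber

/-! ### Closed instances of the recursion rule -/

namespace Term

variable {Sg : Signature.{v}} {Var : Type u}

/-- A closed instance of the recursion rule passes from the unfolding of a closed recursion term to
that term. -/
theorem mu_subst (V : Set Var) (S : V → Term Sg Var Var) (X : V)
    (σ : Var → ClosedTerm Sg Var) : ∃ S' : V → Term Sg Var (PEmpty ⊕ V),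
      (mu V S X).subst σ = fix V S' X ∧ (muTerm V S (S X)).subst σ = unfold V S' X := by
  classical
  refine ⟨_, rfl, ?_⟩
  rw [muTerm, unfold, subst_subst, subst_rename, subst_subst]
  congr 1
  funext y
  simp only [Function.comp_apply]
  split_ifs with h
  · rfl
  · simp only [subst, lift, Sum.elim_inl]
    rw [subst_rename, subst_closed]

/-- Every closed recursion term is a substitution instance of an open one. -/
theorem exists_mu_subst (V : Set Var) (S : V → Term Sg Var (PEmpty ⊕ V)) (X : V) :
    ∃ S' : V → Term Sg Var Var, ∀ σ : Var → ClosedTerm Sg Var,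
      (mu V S' X).subst σ = fix V S X ∧ (muTerm V S' (S' X)).subst σ = unfold V S X := by
  classical
  -- The bound variables are released under their own names, and `mu` captures them again.
  have key : ∀ (Y : V) (σ : Var → ClosedTerm Sg Var),
      (mu V (fun Y => rename (Sum.elim PEmpty.elim Subtype.val) (S Y)) Y).subst σ =
        fix V S Y := by
    intro Y σ
    simp only [mu, subst, subst_rename]
    congr 1
    funext Z
    conv_rhs => rw [← subst_var (S Z)]
    congr 1
    funext y
    rcases y with y | y
    · exact y.elim
    · simp [lift]
  refine ⟨_, fun σ => ⟨key X σ, ?_⟩⟩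
  rw [muTerm, unfold, subst_subst, subst_rename]
  congr 1
  funext y
  rcases y with y | y
  · exact y.elim
  · simp [key]

end Term

/-! ### Reduction of the well-founded semantics to closed proofs -/

namespace TSS

variable {Sg : Signature.{v}} {Var : Type u} {A : Type w}

/-- The transitions that have a proof consisting of closed transitions. -/
inductive Step (P : TSS Sg Var A) : ClosedTerm Sg Var → A → ClosedTerm Sg Var → Prop
  | rule (r : Rule Sg Var A) (hr : r ∈ P.rules) (σ : Var → ClosedTerm Sg Var)
      (hprem : ∀ t a t', Literal.pos t a t' ∈ r.premises →
        Step P (t.subst σ) a (t'.subst σ)) :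
      Step P (r.source.subst σ) r.label (r.target.subst σ)

variable {P : TSS Sg Var A}

theorem subst_toOpen (t : Term Sg Var Var) (σ : Var → ClosedTerm Sg Var) :
    t.subst (fun x => (σ x).toOpen) = (t.subst σ).toOpen := by
  rw [Term.toOpen, Term.rename_subst]; rfl

theorem Step.provable (hP : P.IsPositive) (N : Set (Literal Sg Var A)) {p q : ClosedTerm Sg Var}
    {a : A} (h : P.Step p a q) : Provable P N (.pos p.toOpen a q.toOpen) := by
  induction h with
  | rule r hr σ hprem ih =>
    have := Provable.rule (P := P) (H := N) r hr (fun x => (σ x).toOpen) (by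
      rintro (⟨t, a, t'⟩ | ⟨t, a⟩) hβ
      · simpa only [Literal.subst, subst_toOpen] using ih t a t' hβ
      · exact absurd hβ (hP r hr t a))
    simpa only [Literal.subst, Rule.conclusion, subst_toOpen] using this

/-- Negative hypotheses are never positive literals, so the positive nodes of the proof come from
rules. Composing each rule instance with `ρ` closes them all. -/
theorem step_of_provable {N : Set (Literal Sg Var A)} (hN : ∀ β ∈ N, ∃ t a, β = .neg t a)
    {β : Literal Sg Var A} (h : Provable P N β) (ρ : Var → ClosedTerm Sg Var) :
    ∀ t a t', β = .pos t a t' → P.Step (t.subst ρ) a (t'.subst ρ) := by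
  induction h with
  | hyp β hβ =>
    rintro t a t' rfl
    obtain ⟨_, _, h⟩ := hN _ hβ
    cases h
  | rule r hr σ hprem ih =>
    intro t a t' h
    cases h
    rw [Term.subst_subst, Term.subst_subst]
    refine Step.rule r hr _ fun t a t' hβ => ?_
    have := ih _ hβ _ _ _ rfl
    rwa [Term.subst_subst, Term.subst_subst] at this

/-- Without negative premises no negative hypothesis contributes to a transition. Hence all stages
of the well-founded semantics agree. -/
theorem derived_undenied_iff (hP : P.IsPositive) (T : TransRel Sg Var A)
    {p q : ClosedTerm Sg Var} {a : A} : P.derived (undenied T) p a q ↔ P.Step p a q := by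
  refine ⟨fun h => ?_, fun h => h.provable hP _⟩
  -- Some closed term is needed to fill the free variables of the proof; `p` is at hand.
  have := step_of_provable (by rintro β ⟨p, a, h, _⟩; exact ⟨_, _, h⟩) h (fun _ => p) _ _ _ rfl
  simpa only [Term.toOpen, Term.subst_rename_closed] using this

theorem certain_iff (hP : P.IsPositive) {p q : ClosedTerm Sg Var} {a : A} :
    P.Certain p a q ↔ P.Step p a q := by
  constructor
  · rintro ⟨l, h⟩
    rw [ctAt] at h
    exact (derived_undenied_iff hP _).1 h
  · intro h
    refine ⟨0, ?_⟩
    rw [ctAt]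
    exact (derived_undenied_iff hP _).2 h

theorem possible_iff (hP : P.IsPositive) {p q : ClosedTerm Sg Var} {a : A} :
    P.Possible p a q ↔ P.Step p a q :=
  ⟨fun h => (derived_undenied_iff hP _).1 (h 0), fun h _ => (derived_undenied_iff hP _).2 h⟩

theorem Step.fix (hP : P.IsNtyftNtyxtWithRecursion) {V : Set Var}
    {S : V → Term Sg Var (PEmpty ⊕ V)} {X : V} {a : A} {p : ClosedTerm Sg Var}
    (h : P.Step (Term.unfold V S X) a p) : P.Step (.fix V S X) a p := by
  obtain ⟨S', hS'⟩ := Term.exists_mu_subst V S X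
  obtain ⟨z, -, hz⟩ := hP.1 V S' X a
  have := Step.rule _ hz (fun _ => p) (by
    rintro t b t' h'
    cases h'
    rw [(hS' _).2]
    exact h)
  rwa [show (Rule.recursion V S' X a z).source = Term.mu V S' X from rfl, (hS' _).1] at this

end TSS

/-! ### Lifting transitions to terms with atoms -/

open AtomTerm

section Lifts

variable {Sg : Signature.{v}} {Var : Type u} {A : Type w} {α : Type z}

/-- The transition `s -b→ s'` can be lifted to terms with atoms, in a monotone way, such that the
lifting yields a transition if the atoms are read as specified by `ρ`. -/
def Lifts (P : TSS Sg Var A) (l ρ : α → ClosedTerm Sg Var) (s : ClosedTerm Sg Var) (b : A)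
    (s' : ClosedTerm Sg Var) : Prop :=
  ∃ F : Fiber l s → Fiber l s', Monotone F ∧
    ∀ m, P.Step (m.1.value ρ) b ((F m).1.value ρ)

/-- The transition `s -b→ s'` can be lifted for terms that are not atoms. -/
def LiftsNonatoms (P : TSS Sg Var A) (l ρ : α → ClosedTerm Sg Var) (s : ClosedTerm Sg Var) (b : A)
    (s' : ClosedTerm Sg Var) : Prop :=
  ∃ F : Fiber l s → Fiber l s', MonotoneOn F {m | ∀ a, m.1 ≠ atom a} ∧
    ∀ m : Fiber l s, (∀ a, m.1 ≠ atom a) → P.Step (m.1.value ρ) b ((F m).1.value ρ)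

variable {P : TSS Sg Var A} {l ρ : α → ClosedTerm Sg Var}

/-- Below an atom lie only itself and the bottom, and above it only itself. Once bottom is sent to
bottom, atoms may be lifted arbitrarily without spoiling monotonicity. -/
theorem LiftsNonatoms.lifts {s s' : ClosedTerm Sg Var} {b : A} (h : LiftsNonatoms P l ρ s b s')
    (hs : P.Step s b s')
    (ha : ∀ a, l a = s → ∃ m : Fiber l s', P.Step (ρ a) b (m.1.value ρ)) :
    Lifts P l ρ s b s' := by
  classical
  obtain ⟨F, hF, hF'⟩ := h
  have ha' : ∀ m : Fiber l s, ∃ m' : Fiber l s', (∃ a, m.1 = atom a) →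
      P.Step (m.1.value ρ) b (m'.1.value ρ) := by
    intro m
    by_cases h : ∃ a, m.1 = atom a
    · obtain ⟨a, h⟩ := h
      have hm := m.2
      rw [h, value_atom, Term.weaken_closed] at hm
      obtain ⟨m', hm'⟩ := ha a hm
      refine ⟨m', fun _ => ?_⟩
      rwa [h, value_atom, Term.weaken_closed]
    · exact ⟨⊥, fun h' => absurd h' h⟩
  choose E hE using ha'
  refine ⟨fun m => if m = ⊥ then ⊥ else if ∃ a, m.1 = atom a then E m else F m,
    fun m n hmn => ?_, fun m => ?_⟩
  · dsimp only
    by_cases hm : m = ⊥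
    · rw [if_pos hm]; exact bot_le
    have hn : n ≠ ⊥ := fun h => hm (le_bot_iff.1 (h ▸ hmn))
    rw [if_neg hm, if_neg hn]
    by_cases hn' : ∃ a, n.1 = atom a
    · obtain ⟨a, ha⟩ := hn'
      have h := hmn
      rw [Fiber.le_def, ha] at h
      rcases h with h | h
      · rw [show m = n from Fiber.ext (h.trans ha.symm)]
      · refine absurd (Fiber.ext ?_) hm
        rw [Fiber.coe_bot, h, ← n.2, ha]
        rfl
    · have hm' : ¬ ∃ a, m.1 = atom a := by
        rintro ⟨a, h⟩
        exact hn' ⟨a, Le.atom_left (l := l) (h ▸ hmn)⟩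
      rw [if_neg hn', if_neg hm']
      exact hF (fun a h => hm' ⟨a, h⟩) (fun a h => hn' ⟨a, h⟩) hmn
  · dsimp only
    split_ifs with h h'
    -- The bottom terms contain no atoms, so the original transition serves.
    · rw [h, Fiber.coe_bot, Fiber.coe_bot, value_ofTerm, value_ofTerm]
      exact hs
    · exact hE m h'
    · exact hF' m fun a h => h' ⟨a, h⟩

/-- The instance of an open term in which the variables are replaced by terms with atoms. -/
def Fiber.app {σ : Var → ClosedTerm Sg Var} (t : Term Sg Var Var) (τ : ∀ x, Fiber l (σ x)) :
    Fiber l (t.subst σ) :=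
  ⟨subst (fun x => (τ x).1) (ofTerm t), by
    rw [value_ofTerm_subst]; congr 1; funext x; exact (τ x).2⟩

theorem Fiber.app_mono {σ : Var → ClosedTerm Sg Var} (t : Term Sg Var Var) :
    Monotone (Fiber.app (l := l) (σ := σ) t) :=
  fun _ _ h => Le.subst _ h (Le.refl _)

theorem Fiber.value_app {σ : Var → ClosedTerm Sg Var} (t : Term Sg Var Var)
    (τ : ∀ x, Fiber l (σ x)) : (Fiber.app t τ).1.value ρ = t.subst fun x => (τ x).1.value ρ :=
  value_ofTerm_subst _ _ _

/-- No well-foundedness of the premises is available, so all right-hand variables are solved for at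
once by a least fixed point, the other variables being parameters. -/
theorem exists_premise_solution {r : Rule Sg Var A} (hr : r ∈ P.rules) (hn : r.IsNtytt)
    (σ : Var → ClosedTerm Sg Var)
    (hp : ∀ t a y, Literal.pos t a (.var y) ∈ r.premises → Lifts P l ρ (t.subst σ) a (σ y)) :
    ∃ G : (∀ x, Fiber l (σ x)) → ∀ x, Fiber l (σ x), Monotone G ∧
      ∀ τ, (∀ x ∈ r.source.fv, G τ x = τ x) ∧
        P.Step (r.source.subst fun x => (G τ x).1.value ρ) r.label
          (r.target.subst fun x => (G τ x).1.value ρ) := by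
  classical
  -- `Φ τ₀ τ` is the new value at `y`: the lifted target of the unique premise with right-hand side
  -- `y`, computed from `τ`, or the parameter `τ₀ y` if there is no such premise.
  have step : ∀ y, ∃ Φ : (∀ x, Fiber l (σ x)) → (∀ x, Fiber l (σ x)) → Fiber l (σ y),
      (∀ τ₀ τ₀' τ τ', τ₀ ≤ τ₀' → τ ≤ τ' → Φ τ₀ τ ≤ Φ τ₀' τ') ∧
      ((∀ t a, Literal.pos t a (.var y) ∉ r.premises) → ∀ τ₀ τ, Φ τ₀ τ = τ₀ y) ∧
      ∀ t a, Literal.pos t a (.var y) ∈ r.premises → ∀ τ₀ τ,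
        P.Step ((Fiber.app t τ).1.value ρ) a ((Φ τ₀ τ).1.value ρ) := by
    intro y
    by_cases h : ∃ t a, Literal.pos t a (.var y) ∈ r.premises
    · obtain ⟨t, a, h⟩ := h
      obtain ⟨F, hF, hF'⟩ := hp t a y h
      refine ⟨fun _ τ => F (Fiber.app t τ), fun _ _ _ _ _ h => hF (Fiber.app_mono t h),
        fun h' => absurd h (h' t a), fun t' a' h' τ₀ τ => ?_⟩
      obtain ⟨rfl, rfl⟩ := hn.2 _ _ _ _ _ h h'
      exact hF' _
    · exact ⟨fun τ₀ _ => τ₀ y, fun _ _ _ _ h _ => h y, fun _ _ _ => rfl,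
        fun t a h' => absurd ⟨t, a, h'⟩ h⟩
  choose Φ hmono hfree hstep using step
  choose G hG hleast using fun τ₀ => exists_least_fixedPoint Fiber.exists_isLUB_pi
    (fun τ y => Φ y τ₀ τ) (fun τ τ' h y => hmono y _ _ _ _ le_rfl h)
  refine ⟨G, fun τ τ' h => hleast τ _ ?_, fun τ => ⟨fun x hx => ?_, ?_⟩⟩
  -- For `τ ≤ τ'`, `G τ'` is a pre-fixed point of the operator with parameter `τ`, hence above `G
  -- τ`.
  · conv_rhs => rw [← hG τ']
    exact fun y => hmono y _ _ _ _ h le_rfl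
  · rw [← hG τ]
    refine hfree x (fun t a h => ?_) _ _
    obtain ⟨y, h, hy⟩ := hn.1 _ _ _ h
    cases h
    exact hy hx
  · refine TSS.Step.rule r hr _ fun t a t' h => ?_
    obtain ⟨y, rfl, -⟩ := hn.1 _ _ _ h
    have := hstep y t a h τ (G τ)
    rw [Fiber.value_app, show Φ y τ (G τ) = G τ y from congrFun (hG τ) y] at this
    exact this

/-- A variable as source matches every term, so atoms need no separate treatment. -/
theorem lifts_of_ntyxt {r : Rule Sg Var A} (hr : r ∈ P.rules) (hn : r.IsNtyxt)
    (σ : Var → ClosedTerm Sg Var)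
    (hp : ∀ t a y, Literal.pos t a (.var y) ∈ r.premises → Lifts P l ρ (t.subst σ) a (σ y)) :
    Lifts P l ρ (r.source.subst σ) r.label (r.target.subst σ) := by
  classical
  obtain ⟨G, hG, hG'⟩ := exists_premise_solution hr hn.1 σ hp
  obtain ⟨-, x, hx⟩ := hn
  rw [hx] at hG' ⊢
  change Lifts P l ρ (σ x) _ _
  refine ⟨fun m => Fiber.app r.target (G (Function.update ⊥ x m)), fun m n h => ?_, fun m => ?_⟩
  · refine Fiber.app_mono _ (hG fun y => ?_)
    by_cases hy : y = x
    · subst hy; simpa using h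
    · simp [hy]
  · obtain ⟨h, h'⟩ := hG' (Function.update ⊥ x m)
    rw [Fiber.value_app]
    simp only [Term.subst] at h'
    rwa [h x (Set.mem_singleton x), Function.update_self] at h'

/-- The arguments of a term with an operator at the root. -/
def AtomTerm.arg {W : Type u} : AtomTerm Sg Var α W → ℕ → AtomTerm Sg Var α W
  | op f ts, n => if h : n < Sg.arity f then ts ⟨n, h⟩ else op f ts
  | m, _ => m

/-- A non-atom whose value has root `f` has root `f` itself, so it matches the source and its
arguments supply the source variables. -/
theorem liftsNonatoms_of_ntyft {r : Rule Sg Var A} (hr : r ∈ P.rules) (hn : r.IsNtyft)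
    (σ : Var → ClosedTerm Sg Var)
    (hp : ∀ t a y, Literal.pos t a (.var y) ∈ r.premises → Lifts P l ρ (t.subst σ) a (σ y)) :
    LiftsNonatoms P l ρ (r.source.subst σ) r.label (r.target.subst σ) := by
  classical
  obtain ⟨G, hG, hG'⟩ := exists_premise_solution hr hn.1 σ hp
  obtain ⟨-, f, x, hx, hsrc⟩ := hn
  rw [hsrc] at hG' ⊢
  -- `idx` inverts `x` on its range. The test on values in `τ` puts the argument into the fibre over
  -- `σ y` without a transport; all other variables start at bottom.
  let idx : Var → ℕ := Function.extend x (fun i => (i : ℕ)) 0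
  let τ : Fiber l ((Term.op f fun i => Term.var (x i)).subst σ) → ∀ y, Fiber l (σ y) := fun m y =>
    if h : y ∈ Set.range x ∧ value l (m.1.arg (idx y)) = σ y then ⟨m.1.arg (idx y), h.2⟩ else ⊥
  have hτ : ∀ m y, y ∉ Set.range x → τ m y = ⊥ := fun m y hy => dif_neg fun h => hy h.1
  have hτ' : ∀ m : Fiber l ((Term.op f fun i => Term.var (x i)).subst σ), (∀ a, m.1 ≠ atom a) →
      m.1 = op f fun i => (τ m (x i)).1 := by
    intro m hm
    obtain ⟨ms, hms, h⟩ := (eq_op_of_value m.2).resolve_left fun ⟨a, h⟩ => hm a h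
    rw [hms]
    congr 1
    funext i
    have hi : m.1.arg (idx (x i)) = ms i := by
      simp only [idx, hx.extend_apply, hms, AtomTerm.arg, Fin.is_lt, dite_true]
    have h' : x i ∈ Set.range x ∧ value l (m.1.arg (idx (x i))) = σ (x i) :=
      ⟨⟨i, rfl⟩, by rw [hi]; exact h i⟩
    have h'' : τ m (x i) = ⟨_, h'.2⟩ := dif_pos h'
    rw [h'']
    exact hi.symm
  refine ⟨fun m => Fiber.app r.target (G (τ m)), fun m hm n hn h => ?_, fun m hm => ?_⟩
  · refine Fiber.app_mono _ (hG fun y => ?_)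
    by_cases hy : y ∈ Set.range x
    · obtain ⟨i, rfl⟩ := hy
      rw [Fiber.le_def, hτ' m hm, hτ' n hn] at h
      exact Le.op_iff.1 h i
    · rw [hτ _ _ hy]; exact bot_le
  · obtain ⟨h, h'⟩ := hG' (τ m)
    rw [Fiber.value_app]
    convert h' using 1
    conv_lhs => rw [hτ' m hm]
    simp only [value_op, Term.subst]
    congr 1
    funext i
    rw [h (x i) ⟨i, rfl⟩]

/-- The unfolding of a recursion term. -/
def AtomTerm.unfold : AtomTerm Sg Var α PEmpty.{u + 1} → AtomTerm Sg Var α PEmpty.{u + 1}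
  | fix V S X => subst (Sum.elim PEmpty.elim (fix V S)) (S X)
  | m => m

theorem AtomTerm.value_unfold (l : α → ClosedTerm Sg Var) (V : Set Var)
    (S : V → AtomTerm Sg Var α (PEmpty ⊕ V)) (X : V) :
    value l (fix V S X).unfold = Term.unfold V (fun Y => value l (S Y)) X := by
  rw [AtomTerm.unfold, value_subst, Term.unfold]
  congr 1
  funext y
  rcases y with y | y
  · exact y.elim
  · exact value_fix l V S y

/-- Away from atoms, unfolding is monotone and commutes with both readings. -/
theorem liftsNonatoms_fix (hP : P.IsNtyftNtyxtWithRecursion) {V : Set Var}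
    {S : V → Term Sg Var (PEmpty ⊕ V)} {X : V} {b : A} {s' : ClosedTerm Sg Var}
    (h : Lifts P l ρ (Term.unfold V S X) b s') : LiftsNonatoms P l ρ (.fix V S X) b s' := by
  classical
  obtain ⟨F, hF, hF'⟩ := h
  have key : ∀ m : Fiber l (.fix V S X), (∀ a, m.1 ≠ atom a) →
      ∃ S', m.1 = fix V S' X ∧ value l m.1.unfold = Term.unfold V S X := by
    intro m hm
    obtain ⟨S', hS', h⟩ := (eq_fix_of_value m.2).resolve_left fun ⟨a, h⟩ => hm a h
    exact ⟨S', hS', by rw [hS', value_unfold, funext h]⟩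
  refine ⟨fun m => if h : value l m.1.unfold = Term.unfold V S X then F ⟨m.1.unfold, h⟩ else ⊥,
    fun m hm n hn hmn => ?_, fun m hm => ?_⟩
  · obtain ⟨M, hM, h⟩ := key m hm
    obtain ⟨N, hN, h'⟩ := key n hn
    dsimp only
    rw [dif_pos h, dif_pos h']
    apply hF
    rw [Fiber.le_def, hM, hN] at hmn
    rw [Fiber.le_def]
    simp only [hM, hN, AtomTerm.unfold]
    refine Le.subst _ (fun y => ?_) (Le.fix_iff.1 hmn X)
    rcases y with y | y
    · exact y.elim
    · exact Le.fix (Le.fix_iff.1 hmn)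
  · obtain ⟨M, hM, h⟩ := key m hm
    dsimp only
    rw [dif_pos h]
    have := hF' ⟨m.1.unfold, h⟩
    simp only [hM, value_unfold] at this
    simp only [hM, value_fix]
    exact this.fix hP

/-- Besides the transition, `hatom` may use the lifting already found for non-atoms and, for a
recursion term, the lifting from its unfolding; the atoms for recursion need both. -/
theorem TSS.Step.lifts (hP : P.IsNtyftNtyxtWithRecursion)
    (hatom : ∀ s b s', P.Step s b s' → LiftsNonatoms P l ρ s b s' →
      (∀ V S X, s = .fix V S X → Lifts P l ρ (Term.unfold V S X) b s') →
      ∀ a, l a = s → ∃ m : Fiber l s', P.Step (ρ a) b (m.1.value ρ))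
    {s s' : ClosedTerm Sg Var} {b : A} (h : P.Step s b s') : Lifts P l ρ s b s' := by
  induction h with
  | rule r hr σ hprem ih =>
    have hp : ∀ t a y, Literal.pos t a (.var y) ∈ r.premises → Lifts P l ρ (t.subst σ) a (σ y) :=
      fun t a y h => ih t a _ h
    have hs := TSS.Step.rule r hr σ hprem
    rcases hP.2 r hr with ⟨V, S, X, a, z, -, rfl⟩ | hn | hn
    · obtain ⟨S', hS', hu⟩ := Term.mu_subst V S X σ
      have hl := ih _ _ _ (Set.mem_singleton _)
      rw [hu] at hl
      rw [show (Rule.recursion V S X a z).source = Term.mu V S X from rfl, hS'] at hs ⊢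
      refine (liftsNonatoms_fix hP hl).lifts hs (hatom _ _ _ hs (liftsNonatoms_fix hP hl) ?_)
      intro V₁ S₁ X₁ h
      cases h
      exact hl
    · have hl := liftsNonatoms_of_ntyft hr hn σ hp
      refine hl.lifts hs (hatom _ _ _ hs hl ?_)
      obtain ⟨-, f, x, -, hx⟩ := hn
      intro V S X h
      rw [hx] at h
      cases h
    · exact lifts_of_ntyxt hr hn σ hp

end Lifts

/-! ### Bisimilarity and its closure under contexts -/

section

variable {Sg : Signature.{v}} {Var : Type u} {A : Type w} {P : TSS Sg Var A}

namespace TSS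

theorem isBisimulation_iff (hP : P.IsPositive)
    {R : ClosedTerm Sg Var → ClosedTerm Sg Var → Prop} :
    P.IsBisimulation R ↔ ∀ p q, R p q → ∀ a,
      (∀ p', P.Step p a p' → ∃ q', P.Step q a q' ∧ R p' q') ∧
      (∀ q', P.Step q a q' → ∃ p', P.Step p a p' ∧ R p' q') := by
  simp only [IsBisimulation, certain_iff hP, possible_iff hP]

theorem BisimLE.refl (P : TSS Sg Var A) (p : ClosedTerm Sg Var) : P.BisimLE p p :=
  ⟨Eq, by
    rintro p _ rfl a
    exact ⟨fun p' h => ⟨p', h, rfl⟩, fun p' h => ⟨p', h, rfl⟩⟩, rfl⟩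

theorem BisimLE.trans {p q r : ClosedTerm Sg Var} : P.BisimLE p q → P.BisimLE q r →
    P.BisimLE p r := by
  rintro ⟨R, hR, hpq⟩ ⟨R', hR', hqr⟩
  refine ⟨Relation.Comp R R', ?_, q, hpq, hqr⟩
  rintro p r ⟨q, hpq, hqr⟩ a
  constructor
  · intro p' hp
    obtain ⟨q', hq, hpq'⟩ := (hR p q hpq a).1 p' hp
    obtain ⟨r', hr, hqr'⟩ := (hR' q r hqr a).1 q' hq
    exact ⟨r', hr, q', hpq', hqr'⟩
  · intro r' hr
    obtain ⟨q', hq, hqr'⟩ := (hR' q r hqr a).2 r' hr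
    obtain ⟨p', hp, hpq'⟩ := (hR p q hpq a).2 q' hq
    exact ⟨p', hp, q', hpq', hqr'⟩

theorem BisimLE.symm (hP : P.IsPositive) {p q : ClosedTerm Sg Var} :
    P.BisimLE p q → P.BisimLE q p := by
  rintro ⟨R, hR, hpq⟩
  rw [isBisimulation_iff hP] at hR
  exact ⟨flip R, (isBisimulation_iff hP).2 fun q p h a => (hR p q h a).symm, hpq⟩

theorem BisimLE.step (hP : P.IsPositive) {p q p' : ClosedTerm Sg Var} {a : A}
    (h : P.BisimLE p q) (hp : P.Step p a p') : ∃ q', P.Step q a q' ∧ P.BisimLE p' q' := by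
  obtain ⟨R, hR, hpq⟩ := h
  obtain ⟨q', hq, h⟩ := ((isBisimulation_iff hP).1 hR p q hpq a).1 p' hp
  exact ⟨q', hq, R, hR, h⟩

/-- Bisimilar closed terms may be substituted for each other in any context. -/
theorem bisimLE_value (hP : P.IsTyftTyxtWithRecursion) {α : Type z}
    {l ρ : α → ClosedTerm Sg Var} (h : ∀ a, P.BisimLE (l a) (ρ a))
    (m : AtomTerm Sg Var α PEmpty.{u + 1}) : P.BisimLE (value l m) (value ρ m) := by
  -- All bisimilar pairs serve as atoms, not only those indexed by `α`, so that a transition of an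
  -- atom can end in an atom.
  let β := {x : ClosedTerm Sg Var × ClosedTerm Sg Var // P.BisimLE x.1 x.2}
  let l' : β → ClosedTerm Sg Var := fun x => x.1.1
  let ρ' : β → ClosedTerm Sg Var := fun x => x.1.2
  let R : ClosedTerm Sg Var → ClosedTerm Sg Var → Prop := fun p q =>
    ∃ n : AtomTerm Sg Var β PEmpty.{u + 1}, value l' n = p ∧ value ρ' n = q
  have hsymm : ∀ p q, R p q → R q p := by
    rintro _ _ ⟨n, rfl, rfl⟩
    exact ⟨map (fun x : β => (⟨x.1.swap, x.2.symm hP.1⟩ : β)) n, value_map _ _ _, value_map _ _ _⟩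
  have hsim : ∀ p q, R p q → ∀ a p', P.Step p a p' → ∃ q', P.Step q a q' ∧ R p' q' := by
    rintro _ _ ⟨n, rfl, rfl⟩ a p' hp
    obtain ⟨F, -, hF⟩ := hp.lifts (l := l') (ρ := ρ') hP.2 (by
      rintro s b s' hs - - x rfl
      obtain ⟨q', hq, h⟩ := x.2.step hP.1 hs
      exact ⟨⟨atom ⟨(s', q'), h⟩, Term.weaken_closed _⟩, by
        rwa [value_atom, Term.weaken_closed]⟩)
    exact ⟨_, hF ⟨n, rfl⟩, _, (F ⟨n, rfl⟩).2, rfl⟩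
  refine ⟨R, (isBisimulation_iff hP.1).2 fun p q hpq a => ⟨hsim p q hpq a, fun q' hq => ?_⟩,
    map (fun a => (⟨(l a, ρ a), h a⟩ : β)) m, value_map _ _ _, value_map _ _ _⟩
  obtain ⟨p', hp, h⟩ := hsim q p (hsymm _ _ hpq) a q' hq
  exact ⟨p', hp, hsymm _ _ h⟩

theorem BisimLE.op (hP : P.IsTyftTyxtWithRecursion) (f : Sg.Decl)
    (p q : Fin (Sg.arity f) → ClosedTerm Sg Var) (h : ∀ i, P.BisimLE (p i) (q i)) :
    P.BisimLE (.op f p) (.op f q) := by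
  have := bisimLE_value hP h (AtomTerm.op f atom)
  simpa only [value_op, value_atom, Term.weaken_closed] using this

/-! ### Congruence for recursion -/

section Recursion

variable {W : Set Var} {S S' : W → Term Sg Var W}

theorem unfold_closedMu (S : W → Term Sg Var W) (X : W) :
    Term.unfold W (fun Y => Term.rename Sum.inr (S Y)) X = (S X).subst (Term.closedMu W S) := by
  rw [Term.unfold, Term.subst_rename]
  rfl

/-- The pairs of closed terms `(t⟨S⟩, q)` with `q` bisimilar to `t⟨S'⟩`. -/
def MuPair (P : TSS Sg Var A) (S S' : W → Term Sg Var W) : Type (max (u + 1) v) :=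
  {x : ClosedTerm Sg Var × ClosedTerm Sg Var // ∃ t : Term Sg Var W,
    x.1 = t.subst (Term.closedMu W S) ∧ P.BisimLE (t.subst (Term.closedMu W S')) x.2}

/-- The left component of a pair. -/
def MuPair.left (x : MuPair P S S') : ClosedTerm Sg Var := x.1.1

/-- The right component of a pair. -/
def MuPair.right (x : MuPair P S S') : ClosedTerm Sg Var := x.1.2

/-- The pair of `⟨X|S⟩` and `⟨X|S'⟩`. -/
def MuPair.mk (P : TSS Sg Var A) (S S' : W → Term Sg Var W) (X : W) : MuPair P S S' :=
  ⟨(Term.closedMu W S X, Term.closedMu W S' X), .var X, rfl, .refl _ _⟩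

/-- Each atom is replaced by its witnessing term `t`. This is exact on the left and correct up to
bisimilarity on the right, by `bisimLE_value`. -/
theorem exists_term_of_muPair (hP : P.IsTyftTyxtWithRecursion)
    (m : AtomTerm Sg Var (MuPair P S S') PEmpty.{u + 1}) : ∃ t : Term Sg Var W,
      value MuPair.left m = t.subst (Term.closedMu W S) ∧
      P.BisimLE (t.subst (Term.closedMu W S')) (value MuPair.right m) := by
  choose T hT hT' using fun x : MuPair P S S' => x.2
  refine ⟨eval T (rename PEmpty.elim m), ?_, ?_⟩
  · rw [subst_eval_rename]
    congr 1
    funext x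
    exact hT x
  · rw [subst_eval_rename]
    exact bisimLE_value hP hT' m

/-- The pair `(s, q)` is itself a legitimate atom, so bisimilarity on the right is absorbed into a
single atom. -/
theorem exists_fiber_of_bisimLE (hP : P.IsTyftTyxtWithRecursion) {s q : ClosedTerm Sg Var}
    (m : Fiber (MuPair.left (P := P) (S := S) (S' := S')) s)
    (h : P.BisimLE (m.1.value MuPair.right) q) :
    ∃ m' : Fiber (MuPair.left (P := P) (S := S) (S' := S')) s, m'.1.value MuPair.right = q := by
  obtain ⟨t, ht, ht'⟩ := exists_term_of_muPair hP m.1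
  exact ⟨⟨atom ⟨(s, q), t, m.2 ▸ ht, ht'.trans h⟩, Term.weaken_closed _⟩, Term.weaken_closed _⟩

/-- The instance of a term over `W` in which `X` becomes the pair of `⟨X|S⟩` and `⟨X|S'⟩`. -/
def muFiber (P : TSS Sg Var A) (S S' : W → Term Sg Var W) (t : Term Sg Var W) :
    Fiber (MuPair.left (P := P) (S := S) (S' := S')) (t.subst (Term.closedMu W S)) :=
  ⟨subst (fun X => atom (.mk P S S' X)) (ofTerm t), by
    simp only [value_ofTerm_subst, value_atom, Term.weaken_closed]; rfl⟩

theorem value_muFiber (t : Term Sg Var W) :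
    (muFiber P S S' t).1.value MuPair.right = t.subst (Term.closedMu W S') := by
  simp only [muFiber, value_ofTerm_subst, value_atom, Term.weaken_closed]; rfl

/-- For an atom given by a variable `X`, the lifting of the unfolding yields a transition of
`S_X⟨S'⟩`. The hypothesis at the substitution `Term.closedMu W S'` matches it from `S'_X⟨S'⟩`, and
the recursion rule gives one of `⟨X|S'⟩`. -/
theorem Step.lifts_muPair (hP : P.IsTyftTyxtWithRecursion)
    (h : ∀ (Y : W) (σ : W → ClosedTerm Sg Var), P.BisimLE ((S Y).subst σ) ((S' Y).subst σ))
    {s s' : ClosedTerm Sg Var} {b : A} (hs : P.Step s b s') :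
    Lifts P (MuPair.left (P := P) (S := S) (S' := S')) MuPair.right s b s' := by
  refine hs.lifts hP.2 ?_
  rintro s b s' - ⟨F, -, hF⟩ hfix x rfl
  obtain ⟨t, ht, hx⟩ := x.2
  change x.left = _ at ht
  by_cases hX : ∃ X, t = .var X
  · obtain ⟨X, rfl⟩ := hX
    have hl := hfix _ _ _ ht
    rw [unfold_closedMu] at hl
    obtain ⟨F', -, hF'⟩ := hl
    have h₁ := hF' (muFiber P S S' (S X))
    rw [value_muFiber] at h₁
    obtain ⟨q, hq, h₂⟩ := (h X _).step hP.1 h₁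
    rw [← unfold_closedMu] at hq
    obtain ⟨q', hq', h₃⟩ := hx.step hP.1 (hq.fix hP.2)
    obtain ⟨m, rfl⟩ := exists_fiber_of_bisimLE hP _ (h₂.trans h₃)
    exact ⟨m, hq'⟩
  -- Here the instance keeps the root of `t`, so it is not an atom and the lifting for non-atoms
  -- applies.
  · have h₁ := hF ⟨(muFiber P S S' t).1, (muFiber P S S' t).2.trans ht.symm⟩ (by
      intro a
      cases t with
      | var X => exact absurd ⟨X, rfl⟩ hX
      | op f ts => simp [muFiber, ofTerm, AtomTerm.subst]
      | fix V S X => simp [muFiber, ofTerm, AtomTerm.subst])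
    simp only [value_muFiber] at h₁
    obtain ⟨q', hq', h₃⟩ := hx.step hP.1 h₁
    obtain ⟨m, rfl⟩ := exists_fiber_of_bisimLE hP _ h₃
    exact ⟨m, hq'⟩

/-- Bisimilarity is allowed at both ends so that the converse simulation is the same statement with
`S` and `S'` exchanged. -/
theorem Step.closedMu (hP : P.IsTyftTyxtWithRecursion)
    (h : ∀ (Y : W) (σ : W → ClosedTerm Sg Var), P.BisimLE ((S Y).subst σ) ((S' Y).subst σ))
    {t : Term Sg Var W} {p q p' : ClosedTerm Sg Var} {a : A}
    (hp : P.BisimLE p (t.subst (Term.closedMu W S)))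
    (hq : P.BisimLE (t.subst (Term.closedMu W S')) q) (hs : P.Step p a p') :
    ∃ (q' : ClosedTerm Sg Var) (t' : Term Sg Var W), P.Step q a q' ∧ P.BisimLE p' (t'.subst (Term.closedMu W S)) ∧
      P.BisimLE (t'.subst (Term.closedMu W S')) q' := by
  obtain ⟨r, hr, hpr⟩ := hp.step hP.1 hs
  obtain ⟨F, -, hF⟩ := hr.lifts_muPair hP h
  have h₁ := hF (muFiber P S S' t)
  rw [value_muFiber] at h₁
  obtain ⟨q', hq', h₂⟩ := hq.step hP.1 h₁
  obtain ⟨t', ht', h₃⟩ := exists_term_of_muPair hP (F (muFiber P S S' t)).1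
  rw [(F (muFiber P S S' t)).2] at ht'
  exact ⟨q', t', hq', ht' ▸ hpr, h₃.trans h₂⟩

theorem BisimLE.recursion (hP : P.IsTyftTyxtWithRecursion)
    (h : ∀ (Y : W) (σ : W → ClosedTerm Sg Var), P.BisimLE ((S Y).subst σ) ((S' Y).subst σ))
    (X : W) : P.BisimLE (Term.closedMu W S X) (Term.closedMu W S' X) := by
  refine ⟨fun p q => ∃ t : Term Sg Var W, P.BisimLE p (t.subst (Term.closedMu W S)) ∧
    P.BisimLE (t.subst (Term.closedMu W S')) q, (isBisimulation_iff hP.1).2 ?_,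
    .var X, .refl _ _, .refl _ _⟩
  rintro p q ⟨t, hp, hq⟩ a
  constructor
  · intro p' hs
    obtain ⟨q', t', hq', h₁, h₂⟩ := Step.closedMu hP h hp hq hs
    exact ⟨q', hq', t', h₁, h₂⟩
  · intro q' hs
    obtain ⟨p', t', hp', h₁, h₂⟩ := Step.closedMu hP (fun Y σ => (h Y σ).symm hP.1)
      (hq.symm hP.1) (hp.symm hP.1) hs
    exact ⟨p', hp', t', h₂.symm hP.1, h₁.symm hP.1⟩

end Recursion

theorem isFullCongruence_bisimLE (hP : P.IsTyftTyxtWithRecursion) :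
    IsFullCongruence P.BisimLE where
  refl := .refl P
  trans _ _ _ := .trans
  op := .op hP
  recursion _ _ _ := .recursion hP
  symm _ _ := .symm hP.1

end TSS

end

end SOS

theorem mainTheorem2 {Sg : SOS.Signature.{v}} {Var : Type u} {A : Type w}
    (P : SOS.TSS Sg Var A) (hP : P.IsTyftTyxtWithRecursion) :
    SOS.IsFullCongruence P.BisimLE ∧ SOS.IsFullCongruence P.BisimEquiv := by
  have h : P.BisimEquiv = P.BisimLE := by
    funext p q
    exact propext ⟨And.left, fun h => ⟨h, h.symm hP.1⟩⟩
  exact ⟨SOS.TSS.isFullCongruence_bisimLE hP, h ▸ SOS.TSS.isFullCongruence_bisimLE hP⟩
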